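/- For a convex body $K\subset\mathbb{E}^d$, a unit vector $u\in\mathbb{S}^{d-1}$ (a direction) illuminates a boundary point $p\in\partial K$ if $p+\lambda u$ lies in the interior of $K$ for some $\lambda>0$. For a positive integer $m$, $K$ is $m$-fold illuminated by a finite multiset $U$ of directions if each $p\in\partial K$ is illuminated by at least $m$ members of $U$, counted with multiplicity. The $m$-fold illumination number $I^m(K)$ is the smallest cardinality, counted with multiplicity, of a multiset of directions that $m$-fold illuminates $K$. Let $\mathbb{B}^2\subset\mathbb{E}^2$ be the closed unit disk centered at the origin. Then for every point $v\in\mathbb{E}^2\setminus\mathbb{B}^2$ and every integer $m\ge 1$, the one-spike cap body $\widehat{\mathbb{B}^2}(v)=\operatorname{conv}(\mathbb{B}^2\cup\{v\})$ satisfies $$I^m\left(\widehat{\mathbb{B}^2}(v)\right)=2m+1.$$ -/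

import Mathlib

/-- The direction `u` illuminates the point `p` with respect to `K`: the open ray from `p` in the
direction `u` meets the interior of `K`. -/
def Illuminates {d : ℕ} (K : Set (EuclideanSpace ℝ (Fin d)))
    (u : Metric.sphere (0 : EuclideanSpace ℝ (Fin d)) 1) (p : EuclideanSpace ℝ (Fin d)) : Prop :=
  ∃ q ∈ interior K, ∃ t : ℝ, 0 < t ∧ q = p + t • (u : EuclideanSpace ℝ (Fin d))

open Classical in
/-- `K` is `m`-fold illuminated by the multiset `U` of directions: every boundary point of `K` is
illuminated by at least `m` members of `U`, counted with multiplicity. -/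
def IsMFoldIlluminatedBy {d : ℕ} (m : ℕ) (K : Set (EuclideanSpace ℝ (Fin d)))
    (U : Multiset (Metric.sphere (0 : EuclideanSpace ℝ (Fin d)) 1)) : Prop :=
  ∀ p ∈ frontier K, m ≤ U.countP (fun u => Illuminates K u p)

/-- The `m`-fold illumination number of `K`: the least cardinality (with multiplicity) of a
multiset of directions that `m`-fold illuminates `K`. It is `0` if there is no such multiset. -/
noncomputable def mFoldIlluminationNumber {d : ℕ} (m : ℕ)
    (K : Set (EuclideanSpace ℝ (Fin d))) : ℕ :=
  sInf {n : ℕ | ∃ U : Multiset (Metric.sphere (0 : EuclideanSpace ℝ (Fin d)) 1),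
    Multiset.card U = n ∧ IsMFoldIlluminatedBy m K U}

/-- The spiky body of `K` with respect to `V`: the union of the convex hulls of `K` and a point
of `V`. -/
def spikyBody {d : ℕ} (K V : Set (EuclideanSpace ℝ (Fin d))) : Set (EuclideanSpace ℝ (Fin d)) :=
  ⋃ v ∈ V, convexHull ℝ (K ∪ {v})

open scoped RealInnerProductSpace

/-! Lower bound: pick a direction `u` illuminating the apex and unit normals `±n` orthogonal to `u`.
Both are boundary points of the cap body, with supporting lines parallel to `u`. So `u` illuminates
neither, and no direction illuminates both: `2 * m` further directions are needed. Upper bound: take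
`(-1) ^ k • (v + (ε * k) • e)` for `k ≤ 2 * m`, with `e` orthogonal to `v`. Away from the apex, a
direction illuminates as soon as its product with a suitable unit vector is negative. These products
are an affine function of `k` with alternating signs attached, so `le_card_filter_alternating_neg`
applies. -/

lemma inner_lt_of_mem_interior {E : Type*} [NormedAddCommGroup E] [InnerProductSpace ℝ E]
    {K : Set E} {n q : E} {h : ℝ} (hn : n ≠ 0) (hK : ∀ x ∈ K, ⟪n, x⟫ ≤ h)
    (hq : q ∈ interior K) : ⟪n, q⟫ < h := by
  have h0 : ⟪n, n⟫ ≠ 0 := inner_self_ne_zero.2 hn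
  have hcont : Filter.Tendsto (fun t : ℝ => q + t • n) (nhdsWithin 0 (Set.Ioi 0)) (nhds q) := by
    have : Continuous (fun t : ℝ => q + t • n) := by fun_prop
    simpa using (this.tendsto 0).mono_left nhdsWithin_le_nhds
  obtain ⟨t, htK, ht⟩ :=
    ((hcont.eventually (mem_interior_iff_mem_nhds.1 hq)).and self_mem_nhdsWithin).exists
  have h1 := hK _ htK
  rw [inner_add_right, inner_smul_right] at h1
  have h2 : 0 < t * ⟪n, n⟫ :=
    mul_pos ht (lt_of_le_of_ne real_inner_self_nonneg h0.symm)
  linarith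

lemma inner_le_of_mem_convexHull {E : Type*} [NormedAddCommGroup E] [InnerProductSpace ℝ E]
    {s : Set E} {n : E} {h : ℝ} (hs : ∀ x ∈ s, ⟪n, x⟫ ≤ h) :
    ∀ x ∈ convexHull ℝ s, ⟪n, x⟫ ≤ h := by
  have hc : Convex ℝ {x : E | ⟪n, x⟫ ≤ h} :=
    convex_halfSpace_le (innerₛₗ ℝ n).isLinear h
  exact fun x hx => convexHull_min (t := {x : E | ⟪n, x⟫ ≤ h}) hs hc hx

lemma mem_frontier_of_inner_eq {E : Type*} [NormedAddCommGroup E] [InnerProductSpace ℝ E]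
    {K : Set E} {n p : E} {h : ℝ} (hn : n ≠ 0) (hK : ∀ x ∈ K, ⟪n, x⟫ ≤ h)
    (hp : p ∈ K) (hph : ⟪n, p⟫ = h) : p ∈ frontier K :=
  ⟨subset_closure hp, fun hi => (inner_lt_of_mem_interior hn hK hi).ne hph⟩

lemma Illuminates.inner_neg {d : ℕ} {K : Set (EuclideanSpace ℝ (Fin d))}
    {u : Metric.sphere (0 : EuclideanSpace ℝ (Fin d)) 1} {n p : EuclideanSpace ℝ (Fin d)}
    (hu : Illuminates K u p) (hn : n ≠ 0) (hK : ∀ x ∈ K, ⟪n, x⟫ ≤ ⟪n, p⟫) :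
    ⟪n, (u : EuclideanSpace ℝ (Fin d))⟫ < 0 := by
  obtain ⟨q, hq, t, ht, rfl⟩ := hu
  have := inner_lt_of_mem_interior hn hK hq
  rw [inner_add_right, inner_smul_right] at this
  by_contra! h
  linarith [mul_nonneg ht.le h]

/-- The unit vector in the direction of a nonzero vector. -/
noncomputable def unitDirection {d : ℕ} (x : EuclideanSpace ℝ (Fin d)) (hx : x ≠ 0) :
    Metric.sphere (0 : EuclideanSpace ℝ (Fin d)) 1 :=
  ⟨‖x‖⁻¹ • x, by simp [norm_smul, inv_mul_cancel₀ (norm_ne_zero_iff.2 hx)]⟩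

lemma illuminates_unitDirection {d : ℕ} {K : Set (EuclideanSpace ℝ (Fin d))}
    {p x : EuclideanSpace ℝ (Fin d)} (hx : x ≠ 0) {t : ℝ} (ht : 0 < t)
    (h : p + t • x ∈ interior K) : Illuminates K (unitDirection x hx) p := by
  have hx' : ‖x‖ ≠ 0 := norm_ne_zero_iff.2 hx
  refine ⟨_, h, t * ‖x‖, by positivity, ?_⟩
  simp [unitDirection, smul_smul, mul_assoc, mul_inv_cancel₀ hx']

lemma exists_add_smul_mem_ball {E : Type*} [NormedAddCommGroup E] [InnerProductSpace ℝ E]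
    {b x : E} (hb : ‖b‖ ≤ 1) (hx : ⟪b, x⟫ < 0) :
    ∃ t : ℝ, 0 < t ∧ b + t • x ∈ Metric.ball (0 : E) 1 := by
  have hx0 : 0 < ‖x‖ := by
    rw [norm_pos_iff]
    rintro rfl
    simp at hx
  -- This `t` minimizes `‖b + t • x‖`.
  refine ⟨-⟪b, x⟫ / ‖x‖ ^ 2, by apply div_pos <;> [linarith; positivity], ?_⟩
  rw [mem_ball_zero_iff]
  have h := norm_add_sq_real b ((-⟪b, x⟫ / ‖x‖ ^ 2) • x)
  rw [inner_smul_right, norm_smul, mul_pow, Real.norm_eq_abs, sq_abs] at h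
  have h2 : ‖b + (-⟪b, x⟫ / ‖x‖ ^ 2) • x‖ ^ 2 = ‖b‖ ^ 2 - ⟪b, x⟫ ^ 2 / ‖x‖ ^ 2 := by
    rw [h]
    field_simp
    ring
  have h3 : 0 < ⟪b, x⟫ ^ 2 / ‖x‖ ^ 2 := div_pos (by nlinarith) (by positivity)
  nlinarith [norm_nonneg b, norm_nonneg (b + (-⟪b, x⟫ / ‖x‖ ^ 2) • x)]

/-- Among the `2 * m + 1` numbers `(-1) ^ k * (a + b * k)`, at least `m` are negative. -/
lemma le_card_filter_alternating_neg (m : ℕ) (a b : ℝ) (hab : a ≠ 0 ∨ b ≠ 0) :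
    m ≤ ((Finset.range (2 * m + 1)).filter
      (fun k : ℕ => (-1 : ℝ) ^ k * (a + b * k) < 0)).card := by
  classical
  have key : ∃ g : ℕ → ℕ, Set.InjOn g (Finset.range m) ∧ ∀ i ∈ Finset.range m,
      g i ∈ (Finset.range (2 * m + 1)).filter
        (fun k : ℕ => (-1 : ℝ) ^ k * (a + b * k) < 0) := by
    rcases le_or_gt b 0 with hb | hb
    -- Each disjoint pair of neighbours supplies one index: if the odd one fails, the affine value
    -- there is `≤ 0`, so monotonicity makes it negative at the even one. The even partner lies to
    -- the right when `b ≤ 0`, to the left when `b > 0`.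
    · refine ⟨fun i => if 0 < a + b * (2 * i + 1 : ℕ) then 2 * i + 1 else 2 * i + 2, ?_, ?_⟩
      · intro i _ j _ hij
        dsimp only at hij
        split_ifs at hij <;> omega
      · intro i hi
        rw [Finset.mem_range] at hi
        dsimp only
        split_ifs with h
        · rw [Finset.mem_filter, Finset.mem_range]
          refine ⟨by omega, ?_⟩
          rw [pow_succ, pow_mul]
          push_cast at h ⊢
          norm_num
          linarith
        · rw [Finset.mem_filter, Finset.mem_range]
          refine ⟨by omega, ?_⟩
          rw [show 2 * i + 2 = 2 * (i + 1) by ring, pow_mul]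
          push_cast at h ⊢
          norm_num
          rcases hb.lt_or_eq with hb | rfl
          · linarith
          · have ha : a ≠ 0 := by simpa using hab
            have : a ≤ 0 := by linarith
            linarith [lt_of_le_of_ne this ha]
    · refine ⟨fun i => if 0 < a + b * (2 * i + 1 : ℕ) then 2 * i + 1 else 2 * i, ?_, ?_⟩
      · intro i _ j _ hij
        dsimp only at hij
        split_ifs at hij <;> omega
      · intro i hi
        rw [Finset.mem_range] at hi
        dsimp only
        split_ifs with h
        · rw [Finset.mem_filter, Finset.mem_range]
          refine ⟨by omega, ?_⟩
          rw [pow_succ, pow_mul]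
          push_cast at h ⊢
          norm_num
          linarith
        · rw [Finset.mem_filter, Finset.mem_range]
          refine ⟨by omega, ?_⟩
          rw [pow_mul]
          push_cast at h ⊢
          norm_num
          linarith
  obtain ⟨g, hg, hmem⟩ := key
  simpa using Finset.card_le_card_of_injOn g hmem hg

/-- The quarter turn of the plane. -/
noncomputable def quarterTurn (x : EuclideanSpace ℝ (Fin 2)) : EuclideanSpace ℝ (Fin 2) :=
  !₂[-x 1, x 0]

lemma inner_quarterTurn_self (x : EuclideanSpace ℝ (Fin 2)) : ⟪quarterTurn x, x⟫ = 0 := by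
  simp [quarterTurn, PiLp.inner_apply, Fin.sum_univ_two]
  ring

lemma norm_quarterTurn (x : EuclideanSpace ℝ (Fin 2)) : ‖quarterTurn x‖ = ‖x‖ := by
  simp [quarterTurn, EuclideanSpace.norm_eq, Fin.sum_univ_two, add_comm]

lemma inner_sq_add_inner_quarterTurn_sq (b x : EuclideanSpace ℝ (Fin 2)) :
    ⟪b, x⟫ ^ 2 + ⟪b, quarterTurn x⟫ ^ 2 = ‖b‖ ^ 2 * ‖x‖ ^ 2 := by
  simp [quarterTurn, PiLp.inner_apply, EuclideanSpace.norm_sq_eq, Fin.sum_univ_two]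
  ring

/-! ### Geometry of the cap body -/

lemma unitBall_subset_interior_cap {d : ℕ} (v : EuclideanSpace ℝ (Fin d)) :
    Metric.ball (0 : EuclideanSpace ℝ (Fin d)) 1 ⊆
      interior (convexHull ℝ (Metric.closedBall (0 : EuclideanSpace ℝ (Fin d)) 1 ∪ {v})) :=
  interior_maximal (Metric.ball_subset_closedBall.trans
    (Set.subset_union_left.trans (subset_convexHull ℝ _))) Metric.isOpen_ball

lemma isClosed_cap {d : ℕ} (v : EuclideanSpace ℝ (Fin d)) :
    IsClosed (convexHull ℝ (Metric.closedBall (0 : EuclideanSpace ℝ (Fin d)) 1 ∪ {v})) := by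
  have h : convexHull ℝ (Metric.closedBall (0 : EuclideanSpace ℝ (Fin d)) 1 ∪ {v}) =
      (fun q : ℝ × EuclideanSpace ℝ (Fin d) => v + q.1 • (q.2 - v)) ''
        (Set.Icc 0 1 ×ˢ Metric.closedBall 0 1) := by
    rw [Set.union_singleton, convexHull_insert (Metric.nonempty_closedBall.2 zero_le_one),
      (convex_closedBall _ _).convexHull_eq, convexJoin_singleton_left]
    ext x
    simp only [segment_eq_image', Set.mem_iUnion, Set.mem_image, Set.mem_prod, Prod.exists]
    constructor
    · rintro ⟨b, hb, c, hc, rfl⟩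
      exact ⟨c, b, ⟨hc, hb⟩, rfl⟩
    · rintro ⟨c, b, ⟨hc, hb⟩, rfl⟩
      exact ⟨b, hb, c, hc, rfl⟩
  rw [h]
  exact ((isCompact_Icc.prod (isCompact_closedBall _ _)).image (by fun_prop)).isClosed

/-- A boundary point of the cap body other than its apex is illuminated by every direction that
illuminates a suitable point of the unit sphere. -/
lemma exists_normal_of_mem_frontier_cap {d : ℕ} {v p : EuclideanSpace ℝ (Fin d)}
    (hp : p ∈ frontier
      (convexHull ℝ (Metric.closedBall (0 : EuclideanSpace ℝ (Fin d)) 1 ∪ {v}))) (hpv : p ≠ v) :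
    ∃ b : EuclideanSpace ℝ (Fin d), ‖b‖ = 1 ∧ ∀ x (hx : x ≠ 0), ⟪b, x⟫ < 0 →
      Illuminates (convexHull ℝ (Metric.closedBall (0 : EuclideanSpace ℝ (Fin d)) 1 ∪ {v}))
        (unitDirection x hx) p := by
  set B := Metric.closedBall (0 : EuclideanSpace ℝ (Fin d)) 1
  have hpK : p ∈ convexHull ℝ (B ∪ {v}) := (isClosed_cap v).frontier_subset hp
  have hvK : v ∈ convexHull ℝ (B ∪ {v}) := subset_convexHull ℝ _ (by simp)
  have hBne : B.Nonempty := Metric.nonempty_closedBall.2 zero_le_one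
  have hpJ := hpK
  rw [Set.union_singleton, convexHull_insert hBne, (convex_closedBall _ _).convexHull_eq,
    mem_convexJoin] at hpJ
  obtain ⟨v', hv', b, hb, hpb⟩ := hpJ
  obtain rfl : v' = v := hv'
  obtain ⟨s, c, hs, hc, hsc, rfl⟩ := hpb
  have hc0 : 0 < c := by
    refine lt_of_le_of_ne hc ?_
    rintro rfl
    apply hpv
    simp [show s = 1 by linarith]
  have hint : ∀ y ∈ Metric.ball (0 : EuclideanSpace ℝ (Fin d)) 1,
      s • v' + c • y ∈ interior (convexHull ℝ (B ∪ {v'})) := fun y hy =>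
    (convex_convexHull ℝ _).combo_self_interior_mem_interior hvK
      (unitBall_subset_interior_cap v' hy) hs hc0 hsc
  have hb1 : ‖b‖ ≤ 1 := mem_closedBall_zero_iff.1 hb
  refine ⟨b, le_antisymm hb1 ?_, ?_⟩
  -- If `‖b‖ < 1`, the positive weight `c` on an interior point would make `p` interior.
  · by_contra! h
    exact hp.2 (hint b (mem_ball_zero_iff.2 h))
  · intro x hx hbx
    obtain ⟨t, ht, htb⟩ := exists_add_smul_mem_ball hb1 hbx
    refine illuminates_unitDirection hx (mul_pos hc0 ht) ?_
    have := hint _ htb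
    rwa [smul_add, smul_smul, ← add_assoc] at this

/-- The lower bound for the illumination of a cap body of the unit disk. -/
lemma two_mul_add_one_le_card_of_illuminates_cap {m : ℕ} (hm : 1 ≤ m)
    {v : EuclideanSpace ℝ (Fin 2)} (hv : 1 < ‖v‖)
    {U : Multiset (Metric.sphere (0 : EuclideanSpace ℝ (Fin 2)) 1)}
    (hU : IsMFoldIlluminatedBy m
      (convexHull ℝ (Metric.closedBall (0 : EuclideanSpace ℝ (Fin 2)) 1 ∪ {v})) U) :
    2 * m + 1 ≤ Multiset.card U := by
  classical
  set B := Metric.closedBall (0 : EuclideanSpace ℝ (Fin 2)) 1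
  have hv0 : v ≠ 0 := norm_pos_iff.1 (by linarith)
  have hvK : v ∈ convexHull ℝ (B ∪ {v}) := subset_convexHull ℝ _ (by simp)
  have hBK : B ⊆ convexHull ℝ (B ∪ {v}) :=
    Set.subset_union_left.trans (subset_convexHull ℝ _)
  have hsupp : ∀ (n : EuclideanSpace ℝ (Fin 2)) (h : ℝ), ‖n‖ ≤ h → ⟪n, v⟫ ≤ h →
      ∀ x ∈ convexHull ℝ (B ∪ {v}), ⟪n, x⟫ ≤ h := by
    intro n h hn hnv
    refine inner_le_of_mem_convexHull ?_
    rintro x (hx | hx)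
    · refine (real_inner_le_norm n x).trans (le_trans ?_ hn)
      exact mul_le_of_le_one_right (norm_nonneg _) (mem_closedBall_zero_iff.1 hx)
    · obtain rfl : x = v := hx
      exact hnv
  have hvF : v ∈ frontier (convexHull ℝ (B ∪ {v})) :=
    mem_frontier_of_inner_eq hv0
      (hsupp v ⟪v, v⟫ (by rw [real_inner_self_eq_norm_sq]; nlinarith) le_rfl) hvK rfl
  obtain ⟨u, huU, hu⟩ := Multiset.countP_pos.1 (lt_of_lt_of_le hm (hU v hvF))
  have hu1 : ‖(u : EuclideanSpace ℝ (Fin 2))‖ = 1 := by simp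
  have hbound : ∀ n : EuclideanSpace ℝ (Fin 2), ‖n‖ = 1 →
      ⟪n, (u : EuclideanSpace ℝ (Fin 2))⟫ = 0 → ⟪n, v⟫ ≤ 1 := by
    intro n hn hnu
    -- Otherwise `n` supports the body at `v`, and `u`, being orthogonal to `n`, could not
    -- illuminate `v`.
    by_contra! h
    have hn0 : n ≠ 0 := norm_pos_iff.1 (by linarith)
    exact (hu.inner_neg hn0 (hsupp n _ (by linarith) le_rfl)).ne hnu
  have hcount : ∀ n : EuclideanSpace ℝ (Fin 2), ‖n‖ = 1 →
      ⟪n, (u : EuclideanSpace ℝ (Fin 2))⟫ = 0 →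
      m ≤ U.countP (fun w : Metric.sphere (0 : EuclideanSpace ℝ (Fin 2)) 1 =>
        ⟪n, (w : EuclideanSpace ℝ (Fin 2))⟫ < 0) := by
    intro n hn hnu
    have hn0 : n ≠ 0 := norm_pos_iff.1 (by linarith)
    have hnn : ⟪n, n⟫ = 1 := by rw [real_inner_self_eq_norm_sq, hn]; norm_num
    have hs := hsupp n 1 hn.le (hbound n hn hnu)
    have hF : n ∈ frontier (convexHull ℝ (B ∪ {v})) :=
      mem_frontier_of_inner_eq hn0 hs (hBK (mem_closedBall_zero_iff.2 hn.le)) hnn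
    refine (hU n hF).trans ?_
    rw [Multiset.countP_eq_card_filter, Multiset.countP_eq_card_filter]
    refine Multiset.card_le_card (Multiset.monotone_filter_right U ?_)
    intro w hw
    exact hw.inner_neg hn0 (by rwa [hnn])
  set n := quarterTurn (u : EuclideanSpace ℝ (Fin 2)) with hn
  have hn1 : ‖n‖ = 1 := by rw [hn, norm_quarterTurn, hu1]
  have hnu : ⟪n, (u : EuclideanSpace ℝ (Fin 2))⟫ = 0 := inner_quarterTurn_self _
  have h1 := hcount n hn1 hnu
  have h2 := hcount (-n) (by rwa [norm_neg]) (by rw [inner_neg_left, hnu, neg_zero])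
  obtain ⟨W, rfl⟩ := Multiset.exists_cons_of_mem huU
  -- Removing `u` loses nothing from either count, and the two counts concern disjoint parts of `W`.
  rw [Multiset.countP_cons_of_neg _ (by simp [hnu])] at h1 h2
  have h3 := Multiset.card_eq_countP_add_countP
    (fun w : Metric.sphere (0 : EuclideanSpace ℝ (Fin 2)) 1 =>
      ⟪n, (w : EuclideanSpace ℝ (Fin 2))⟫ < 0) W
  have h4 : W.countP (fun w : Metric.sphere (0 : EuclideanSpace ℝ (Fin 2)) 1 =>
        ⟪-n, (w : EuclideanSpace ℝ (Fin 2))⟫ < 0) ≤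
      W.countP (fun w : Metric.sphere (0 : EuclideanSpace ℝ (Fin 2)) 1 =>
        ¬ ⟪n, (w : EuclideanSpace ℝ (Fin 2))⟫ < 0) := by
    rw [Multiset.countP_eq_card_filter, Multiset.countP_eq_card_filter]
    refine Multiset.card_le_card (Multiset.monotone_filter_right W ?_)
    intro w hw
    rw [inner_neg_left] at hw
    linarith
  rw [Multiset.card_cons]
  omega

/-- The upper bound: directions alternating between the two sides of a thin double cone around
the line through the apex. -/
lemma exists_illuminating_multiset_cap (m : ℕ) {v : EuclideanSpace ℝ (Fin 2)} (hv : v ≠ 0) :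
    ∃ U : Multiset (Metric.sphere (0 : EuclideanSpace ℝ (Fin 2)) 1),
      Multiset.card U = 2 * m + 1 ∧ IsMFoldIlluminatedBy m
        (convexHull ℝ (Metric.closedBall (0 : EuclideanSpace ℝ (Fin 2)) 1 ∪ {v})) U := by
  classical
  set e := quarterTurn v with he
  have hvpos : 0 < ‖v‖ := norm_pos_iff.2 hv
  -- Chosen so that `‖(ε * k) • e‖ < 1` for all `k ≤ 2 * m`; then every odd `k` sends the apex into
  -- the open disk.
  set ε : ℝ := ((2 * m + 1) * ‖v‖)⁻¹ with hε
  have hεpos : 0 < ε := by positivity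
  let x : ℕ → EuclideanSpace ℝ (Fin 2) := fun k => (-1 : ℝ) ^ k • (v + (ε * k) • e)
  have hx : ∀ k, x k ≠ 0 := by
    intro k h
    have h1 : v + (ε * k) • e = 0 := (smul_eq_zero.1 h).resolve_left (by simp)
    have h2 : ⟪v, v + (ε * k) • e⟫ = ⟪v, v⟫ := by
      rw [inner_add_right, inner_smul_right, real_inner_comm e v, he, inner_quarterTurn_self,
        mul_zero, add_zero]
    rw [h1, inner_zero_right] at h2
    exact hv (inner_self_eq_zero.1 h2.symm)
  refine ⟨(Multiset.range (2 * m + 1)).map (fun k => unitDirection (x k) (hx k)), by simp, ?_⟩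
  have hle : ∀ (p : EuclideanSpace ℝ (Fin 2)) (a b : ℝ), (a ≠ 0 ∨ b ≠ 0) →
      (∀ k < 2 * m + 1, (-1 : ℝ) ^ k * (a + b * k) < 0 → Illuminates
        (convexHull ℝ (Metric.closedBall (0 : EuclideanSpace ℝ (Fin 2)) 1 ∪ {v}))
        (unitDirection (x k) (hx k)) p) →
      m ≤ ((Multiset.range (2 * m + 1)).map (fun k => unitDirection (x k) (hx k))).countP
        (fun u => Illuminates
          (convexHull ℝ (Metric.closedBall (0 : EuclideanSpace ℝ (Fin 2)) 1 ∪ {v})) u p) := by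
    intro p a b hab h
    refine (le_card_filter_alternating_neg m a b hab).trans ?_
    rw [Multiset.countP_map]
    change _ ≤ ((Finset.range (2 * m + 1)).filter _).card
    refine Finset.card_le_card ?_
    intro k hk
    rw [Finset.mem_filter] at hk ⊢
    exact ⟨hk.1, h k (Finset.mem_range.1 hk.1) hk.2⟩
  intro p hp
  by_cases hpv : p = v
  · subst hpv
    refine le_trans (hle p 1 0 (by simp) ?_) (le_of_eq (by congr))
    intro k hk hneg
    have hsign : (-1 : ℝ) ^ k = -1 := by
      rcases neg_one_pow_eq_or ℝ k with h | h
      · rw [h] at hneg; norm_num at hneg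
      · exact h
    refine illuminates_unitDirection (hx k) one_pos (unitBall_subset_interior_cap p ?_)
    have hq : p + (1 : ℝ) • x k = -((ε * k) • e) := by
      simp only [x, hsign]
      module
    rw [hq, mem_ball_zero_iff, norm_neg, norm_smul, he, norm_quarterTurn, Real.norm_eq_abs,
      abs_of_nonneg (by positivity), hε]
    have hk' : (k : ℝ) < 2 * m + 1 := by exact_mod_cast hk
    rw [show ((2 * (m : ℝ) + 1) * ‖p‖)⁻¹ * k * ‖p‖ = k / (2 * m + 1) by field_simp]
    rwa [div_lt_one (by positivity)]
  · obtain ⟨b, hb, hill⟩ := exists_normal_of_mem_frontier_cap hp hpv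
    refine le_trans (hle p ⟪b, v⟫ (ε * ⟪b, e⟫) ?_ ?_) (le_of_eq (by congr))
    -- A unit vector `b` cannot be orthogonal to both `v` and `e`, which span the plane.
    · by_contra! h
      have h2 : ⟪b, e⟫ = 0 := by simpa [hεpos.ne'] using h.2
      have h3 := inner_sq_add_inner_quarterTurn_sq b v
      rw [h.1, ← he, h2, hb] at h3
      nlinarith
    · intro k _ hneg
      refine hill _ (hx k) ?_
      simp only [x, inner_smul_right, inner_add_right]
      convert hneg using 2
      ring

theorem mainTheorem9 (m : ℕ) (hm : 1 ≤ m) (v : EuclideanSpace ℝ (Fin 2))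
    (hv : v ∉ Metric.closedBall (0 : EuclideanSpace ℝ (Fin 2)) 1) :
    mFoldIlluminationNumber m
      (spikyBody (Metric.closedBall (0 : EuclideanSpace ℝ (Fin 2)) 1) {v}) = 2 * m + 1 := by
  have hv1 : 1 < ‖v‖ := by simpa using hv
  have hK : spikyBody (Metric.closedBall (0 : EuclideanSpace ℝ (Fin 2)) 1) {v} =
      convexHull ℝ (Metric.closedBall (0 : EuclideanSpace ℝ (Fin 2)) 1 ∪ {v}) :=
    Set.biUnion_singleton _ _
  have hmem := exists_illuminating_multiset_cap m (norm_pos_iff.1 (zero_lt_one.trans hv1))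
  rw [hK]
  refine le_antisymm (Nat.sInf_le hmem) (le_csInf ⟨_, hmem⟩ ?_)
  rintro n ⟨U, rfl, hU⟩
  exact two_mul_add_one_le_card_of_illuminates_cap hm hv1 hU
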